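/- Let $M>N$ be natural numbers and let $\beta=1$ (real case, $\mathbb K=\mathbb R$) or $\beta=2$ (complex case, $\mathbb K=\mathbb C$). Let $X$ be a random $M\times N$ matrix over $\mathbb K$ whose distribution has density proportional to $\exp\left(-\frac{\beta}{2}\operatorname{Tr}X^{\dagger}X\right)$ with respect to Lebesgue measure on the matrix space. Write $X=\begin{bmatrix}Y\\ Z\end{bmatrix}$ with $Y$ of size $N\times N$ and $Z$ of size $(M-N)\times N$, and let $$G=\left(\mathbb 1_N+(Y^{\dagger})^{-1}Z^{\dagger}Z\,Y^{-1}\right)^{1/2}Y$$ be the quadratisation of $X$ (defined almost surely, since $Y$ is almost surely invertible). Almost surely, $G$ is the unique $N\times N$ matrix over $\mathbb K$ such that $$X=W\begin{bmatrix}G\\0\end{bmatrix}$$ for some unitary (real orthogonal if $\beta=1$) $M\times M$ matrix $W$ of the block form $$W=\begin{bmatrix}(\mathbb 1_N-CC^{\dagger})^{1/2}&C\\-C^{\dagger}&(\mathbb 1_{M-N}-C^{\dagger}C)^{1/2}\end{bmatrix},$$ with $C$ an $N\times(M-N)$ matrix over $\mathbb K$ and positive semidefinite square roots. Moreover, $G$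 has the induced Ginibre distribution: its law is the probability measure on the $N\times N$ matrices over $\mathbb K$ with density proportional to $$(\det G^{\dagger}G)^{\frac{\beta}{2}(M-N)}\exp\left(-\frac{\beta}{2}\operatorname{Tr}G^{\dagger}G\right)$$ with respect to Lebesgue measure. -/

import Mathlib

open MeasureTheory ProbabilityTheory
open scoped ENNReal Matrix ComplexOrder MatrixOrder

noncomputable section

namespace InducedGinibre

/-- Matrices carry the product `σ`-algebra of their entries. -/
instance instMeasurableSpaceMatrix {m n α : Type*} [MeasurableSpace α] :
    MeasurableSpace (Matrix m n α) :=
  inferInstanceAs (MeasurableSpace (m → n → α))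

/-- Lebesgue measure on the space of `m × n` matrices over `𝕜`: the product over all entries of
Lebesgue measure on `𝕜` (for `𝕜 = ℂ` this is `d(re) d(im)` in every entry). -/
def lebesgue (m n : ℕ) (𝕜 : Type*) [MeasureSpace 𝕜] : Measure (Matrix (Fin m) (Fin n) 𝕜) :=
  (Measure.pi fun _ : Fin m => Measure.pi fun _ : Fin n => (volume : Measure 𝕜))

/-- The measure with density proportional to `f` with respect to `μ`, divided by its total mass. -/
def normalizedWithDensity {α : Type*} [MeasurableSpace α] (μ : Measure α) (f : α → ℝ≥0∞) :
    Measure α :=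
  (∫⁻ x, f x ∂μ)⁻¹ • μ.withDensity f

/-- The Gaussian distribution on `m × n` matrices, with density proportional to
`exp (-(β / 2) Tr X†X)`. -/
def gaussianMatrix (m n : ℕ) (𝕜 : Type*) [RCLike 𝕜] [MeasureSpace 𝕜] (β : ℝ) :
    Measure (Matrix (Fin m) (Fin n) 𝕜) :=
  normalizedWithDensity (lebesgue m n 𝕜) fun X =>
    ENNReal.ofReal (Real.exp (-(β / 2) * RCLike.re (Xᴴ * X).trace))

/-- The induced Ginibre distribution on `n × n` matrices with parameter `L`, with density
proportional to `(det G†G) ^ ((β / 2) L) * exp (-(β / 2) Tr G†G)`. -/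
def inducedGinibre (n : ℕ) (L : ℝ) (𝕜 : Type*) [RCLike 𝕜] [MeasureSpace 𝕜] (β : ℝ) :
    Measure (Matrix (Fin n) (Fin n) 𝕜) :=
  normalizedWithDensity (lebesgue n n 𝕜) fun G =>
    ENNReal.ofReal ((RCLike.re (Gᴴ * G).det) ^ (β / 2 * L) *
      Real.exp (-(β / 2) * RCLike.re (Gᴴ * G).trace))

variable {𝕜 : Type*} [RCLike 𝕜] {M N : ℕ}

/-- The splitting of the `M` row indices into the first `N` and the last `M - N`. -/
def rowEquiv (h : N < M) : Fin N ⊕ Fin (M - N) ≃ Fin M :=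
  finSumFinEquiv.trans (finCongr (Nat.add_sub_of_le h.le))

/-- The upper `N × N` block `Y` of `X`. -/
def upperBlock (h : N < M) (X : Matrix (Fin M) (Fin N) 𝕜) : Matrix (Fin N) (Fin N) 𝕜 :=
  X.submatrix (fun i => rowEquiv h (Sum.inl i)) id

/-- The lower `(M - N) × N` block `Z` of `X`. -/
def lowerBlock (h : N < M) (X : Matrix (Fin M) (Fin N) 𝕜) : Matrix (Fin (M - N)) (Fin N) 𝕜 :=
  X.submatrix (fun i => rowEquiv h (Sum.inr i)) id

/-- The `M × N` matrix with upper block `G` and lower block `0`. -/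
def padZero (h : N < M) (G : Matrix (Fin N) (Fin N) 𝕜) : Matrix (Fin M) (Fin N) 𝕜 :=
  (Matrix.fromRows G 0).submatrix (rowEquiv h).symm id

/-- `W` has the block form `[(1 - CC†)^{1/2}, C; -C†, (1 - C†C)^{1/2}]` for some
`N × (M - N)` matrix `C`; the square roots are the positive semidefinite ones and are
required to exist. -/
def HasCanonicalForm (h : N < M) (W : Matrix (Fin M) (Fin M) 𝕜) : Prop :=
  ∃ (C : Matrix (Fin N) (Fin (M - N)) 𝕜) (A : Matrix (Fin N) (Fin N) 𝕜)
    (D : Matrix (Fin (M - N)) (Fin (M - N)) 𝕜),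
    A.PosSemidef ∧ A * A = 1 - C * Cᴴ ∧ D.PosSemidef ∧ D * D = 1 - Cᴴ * C ∧
      W = Matrix.reindex (rowEquiv h) (rowEquiv h) (Matrix.fromBlocks A C (-Cᴴ) D)

/-- The quadratisation `G = (1 + (Y†)⁻¹ Z† Z Y⁻¹)^{1/2} Y` of a matrix `X` with upper block `Y`
and lower block `Z` (meaningful when `Y` is invertible). -/
def quadratisation (h : N < M) (X : Matrix (Fin M) (Fin N) 𝕜) : Matrix (Fin N) (Fin N) 𝕜 :=
  CFC.sqrt (1 + ((upperBlock h X)ᴴ)⁻¹ * (lowerBlock h X)ᴴ * lowerBlock h X * (upperBlock h X)⁻¹) *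
    upperBlock h X

end InducedGinibre

end

/-! Put `K = Z Y⁻¹` and `H = (1 + K†K)^{1/2}`, so that `G = H Y`. The equation `X = W [G; 0]` says
`Y = A G` and `Z = -C† G`; hence `K = -C† A⁻¹`, `1 + K†K = A⁻²`, and uniqueness of positive square
roots forces `A = H⁻¹`. Conversely this `A` determines a suitable `C`. See
`exists_eq_mul_padZero_iff`.

For the law, unitarity of `W` gives `G†G = X†X`, so the Gaussian weight is a function of `G` and
only the image of Lebesgue measure is needed. With `β = b` and `L = M - N`, replacing `Z` by `K` at
fixed `Y` costs `|det Y|^(bL)`. Replacing `Y` by `G = H Y` at fixed `K` then leaves `|det G|^(bL)`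
times a factor depending on `K` alone, which integrates to a constant (`lintegral_quadratisation`).
Normalisation removes that constant. -/

namespace InducedGinibre

/-! ### Positive square roots and unitary block matrices. -/

section Algebra

variable {𝕜 : Type*} [RCLike 𝕜] {m n : Type*} [Fintype m] [Fintype n]
  [DecidableEq n]

/-- The factor `(1 + K†K)^{1/2}` of the quadratisation, with `K = Z Y⁻¹`. -/
noncomputable def dilation (K : Matrix m n 𝕜) : Matrix n n 𝕜 := CFC.sqrt (1 + Kᴴ * K)

theorem posDef_one_add_conjTranspose_mul_self (K : Matrix m n 𝕜) : (1 + Kᴴ * K).PosDef :=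
  Matrix.PosDef.one.add_posSemidef (Matrix.posSemidef_conjTranspose_mul_self K)

theorem dilation_mul_self (K : Matrix m n 𝕜) : dilation K * dilation K = 1 + Kᴴ * K :=
  CFC.sqrt_mul_sqrt_self _ (posDef_one_add_conjTranspose_mul_self K).posSemidef.nonneg

theorem posSemidef_dilation (K : Matrix m n 𝕜) : (dilation K).PosSemidef :=
  Matrix.nonneg_iff_posSemidef.1 (CFC.sqrt_nonneg _)

theorem det_dilation_ne_zero (K : Matrix m n 𝕜) : (dilation K).det ≠ 0 := by
  intro h0
  have h := congrArg Matrix.det (dilation_mul_self K)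
  rw [Matrix.det_mul, h0, zero_mul] at h
  exact (posDef_one_add_conjTranspose_mul_self K).det_pos.ne h

/-- A homogeneous Sylvester equation with positive coefficients has only the trivial solution. -/
theorem eq_zero_of_mul_add_mul_eq_zero {A : Matrix n n 𝕜} {D : Matrix m m 𝕜} {E : Matrix n m 𝕜}
    (hA : A.PosSemidef) (hAu : IsUnit A.det) (hD : D.PosSemidef) (h : A * E + E * D = 0) :
    E = 0 := by
  have h1 : (Eᴴ * A * E).PosSemidef := hA.conjTranspose_mul_mul_same E
  have h2 : (E * D * Eᴴ).PosSemidef := hD.mul_mul_conjTranspose_same E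
  -- Multiply the equation by `E†` and take traces: two nonnegative numbers sum to zero.
  have h3 : (Eᴴ * A * E).trace + (E * D * Eᴴ).trace = 0 := by
    rw [Matrix.trace_mul_comm (E * D) Eᴴ, Matrix.mul_assoc, ← Matrix.trace_add, ← Matrix.mul_add,
      h, Matrix.mul_zero, Matrix.trace_zero]
  have h4 : (Eᴴ * A * E).trace = 0 :=
    ((add_eq_zero_iff_of_nonneg h1.trace_nonneg h2.trace_nonneg).1 h3).1
  rw [h1.trace_eq_zero_iff] at h4
  have hs : (CFC.sqrt A)ᴴ = CFC.sqrt A := (Matrix.nonneg_iff_posSemidef.1 (CFC.sqrt_nonneg A)).isHermitian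
  have h5 : (CFC.sqrt A * E)ᴴ * (CFC.sqrt A * E) = 0 := by
    rw [Matrix.conjTranspose_mul, hs, ← h4, ← Matrix.mul_assoc, Matrix.mul_assoc Eᴴ,
      CFC.sqrt_mul_sqrt_self A hA.nonneg]
  rw [Matrix.conjTranspose_mul_self_eq_zero] at h5
  have h6 : A * E = 0 := by
    rw [← CFC.sqrt_mul_sqrt_self A hA.nonneg, Matrix.mul_assoc, h5, Matrix.mul_zero]
  rw [← Matrix.nonsing_inv_mul_cancel_left A E hAu, h6, Matrix.mul_zero]

/-- Both matrices are Schur complements of `[1, C; C†, 1]`. -/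
theorem posSemidef_one_sub_conjTranspose_mul_self [DecidableEq m] {C : Matrix n m 𝕜}
    (h : (1 - C * Cᴴ).PosSemidef) : (1 - Cᴴ * C).PosSemidef := by
  have := invertibleOne (α := Matrix n n 𝕜)
  have := invertibleOne (α := Matrix m m 𝕜)
  have h1 := Matrix.PosDef.fromBlocks₂₂ (1 : Matrix n n 𝕜) C (Matrix.PosDef.one (n := m) (R := 𝕜))
  have h2 := Matrix.PosDef.fromBlocks₁₁ C (1 : Matrix m m 𝕜) (Matrix.PosDef.one (n := n) (R := 𝕜))
  simp only [inv_one, Matrix.mul_one] at h1 h2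
  exact h2.1 (h1.2 h)

/-- The off-diagonal blocks of `W W†` vanish once `A C = C D`. The difference `E = A C - C D`
satisfies `A E + E D = A² C - C D² = 0`, hence is zero. -/
theorem fromBlocks_mem_unitaryGroup [DecidableEq m] {A : Matrix n n 𝕜} {C : Matrix n m 𝕜}
    {D : Matrix m m 𝕜}
    (hA : A.PosSemidef) (hAu : IsUnit A.det) (hAC : A * A = 1 - C * Cᴴ) (hD : D.PosSemidef)
    (hDC : D * D = 1 - Cᴴ * C) :
    Matrix.fromBlocks A C (-Cᴴ) D ∈ Matrix.unitaryGroup (n ⊕ m) 𝕜 := by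
  have hcomm : A * C - C * D = 0 := by
    refine eq_zero_of_mul_add_mul_eq_zero hA hAu hD ?_
    rw [Matrix.mul_sub, Matrix.sub_mul, ← Matrix.mul_assoc, hAC, Matrix.mul_assoc C D D, hDC,
      Matrix.mul_sub, Matrix.sub_mul, ← Matrix.mul_assoc, ← Matrix.mul_assoc, Matrix.mul_one,
      Matrix.one_mul]
    abel
  have hAh : Aᴴ = A := hA.isHermitian
  have hDh : Dᴴ = D := hD.isHermitian
  have hcomm' : D * Cᴴ = Cᴴ * A := by
    have := congrArg Matrix.conjTranspose hcomm
    simp only [Matrix.conjTranspose_sub, Matrix.conjTranspose_mul, hAh, hDh,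
      Matrix.conjTranspose_zero] at this
    exact (sub_eq_zero.1 this).symm
  rw [Matrix.mem_unitaryGroup_iff, Matrix.star_eq_conjTranspose, Matrix.fromBlocks_conjTranspose,
    Matrix.fromBlocks_multiply, ← Matrix.fromBlocks_one]
  simp [hAh, hDh, hAC, hDC, hcomm', sub_eq_zero.1 hcomm]

end Algebra

/-! ### Existence and uniqueness of the factorisation. -/

section Blocks

variable {𝕜 : Type*} [RCLike 𝕜] {M N : ℕ}

theorem ext_upperBlock_lowerBlock {R : Type*} (h : N < M) {X X' : Matrix (Fin M) (Fin N) R}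
    (hu : upperBlock h X = upperBlock h X') (hl : lowerBlock h X = lowerBlock h X') : X = X' := by
  ext i j
  obtain ⟨i | i, rfl⟩ := (rowEquiv h).surjective i
  · exact congrFun (congrFun hu i) j
  · exact congrFun (congrFun hl i) j

theorem reindex_mul_padZero (h : N < M) (A : Matrix (Fin N) (Fin N) 𝕜)
    (B : Matrix (Fin N) (Fin (M - N)) 𝕜) (C : Matrix (Fin (M - N)) (Fin N) 𝕜)
    (D : Matrix (Fin (M - N)) (Fin (M - N)) 𝕜) (G : Matrix (Fin N) (Fin N) 𝕜) :
    Matrix.reindex (rowEquiv h) (rowEquiv h) (Matrix.fromBlocks A B C D) * padZero h G =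
      (Matrix.fromRows (A * G) (C * G)).submatrix (rowEquiv h).symm id := by
  rw [padZero, Matrix.reindex_apply, Matrix.submatrix_mul_equiv, Matrix.fromBlocks_mul_fromRows]
  simp

theorem eq_reindex_mul_padZero_iff (h : N < M) (X : Matrix (Fin M) (Fin N) 𝕜)
    (A : Matrix (Fin N) (Fin N) 𝕜)
    (B : Matrix (Fin N) (Fin (M - N)) 𝕜) (C : Matrix (Fin (M - N)) (Fin N) 𝕜)
    (D : Matrix (Fin (M - N)) (Fin (M - N)) 𝕜) (G : Matrix (Fin N) (Fin N) 𝕜) :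
    X = Matrix.reindex (rowEquiv h) (rowEquiv h) (Matrix.fromBlocks A B C D) * padZero h G ↔
      upperBlock h X = A * G ∧ lowerBlock h X = C * G := by
  rw [reindex_mul_padZero]
  constructor
  · rintro rfl
    constructor <;> ext i j <;> simp [upperBlock, lowerBlock]
  · rintro ⟨hu, hl⟩
    apply ext_upperBlock_lowerBlock h
    · rw [hu]; ext i j; simp [upperBlock]
    · rw [hl]; ext i j; simp [lowerBlock]

theorem quadratisation_eq (h : N < M) (X : Matrix (Fin M) (Fin N) 𝕜) :
    quadratisation h X =
      dilation (lowerBlock h X * (upperBlock h X)⁻¹) * upperBlock h X := by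
  rw [quadratisation, dilation, Matrix.conjTranspose_mul, Matrix.conjTranspose_nonsing_inv]
  simp only [Matrix.mul_assoc]

theorem reindex_mem_unitaryGroup {m n : Type*} [Fintype m] [DecidableEq m] [Fintype n]
    [DecidableEq n] (e : m ≃ n) {W : Matrix m m 𝕜} (hW : W ∈ Matrix.unitaryGroup m 𝕜) :
    Matrix.reindex e e W ∈ Matrix.unitaryGroup n 𝕜 := by
  rw [Matrix.mem_unitaryGroup_iff, Matrix.star_eq_conjTranspose] at hW ⊢
  rw [Matrix.conjTranspose_reindex, Matrix.reindex_apply, Matrix.reindex_apply,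
    Matrix.submatrix_mul_equiv, hW, Matrix.submatrix_one_equiv]

theorem eq_quadratisation_of_eq_mul_padZero (h : N < M) {X : Matrix (Fin M) (Fin N) 𝕜}
    (hX : (upperBlock h X).det ≠ 0) {W : Matrix (Fin M) (Fin M) 𝕜} (hW : HasCanonicalForm h W)
    {G : Matrix (Fin N) (Fin N) 𝕜} (hG : X = W * padZero h G) : G = quadratisation h X := by
  obtain ⟨C, A, D, hA, hAC, -, -, rfl⟩ := hW
  obtain ⟨hu, hl⟩ := (eq_reindex_mul_padZero_iff h X A C (-Cᴴ) D G).1 hG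
  have hdet : IsUnit (A.det * G.det) := by
    rw [← Matrix.det_mul, ← hu]; exact hX.isUnit
  have hAu : IsUnit A.det := isUnit_of_mul_isUnit_left hdet
  have hGu : IsUnit G.det := isUnit_of_mul_isUnit_right hdet
  have hK : lowerBlock h X * (upperBlock h X)⁻¹ = -(Cᴴ * A⁻¹) := by
    rw [hu, hl, Matrix.mul_inv_rev, Matrix.mul_assoc, Matrix.mul_nonsing_inv_cancel_left _ _ hGu,
      Matrix.neg_mul]
  have hinv : (A⁻¹).PosSemidef := hA.inv
  -- Conjugate `C C† = 1 - A²` by `A⁻¹`.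
  have hsq : A⁻¹ * A⁻¹ = 1 + (-(Cᴴ * A⁻¹))ᴴ * -(Cᴴ * A⁻¹) := by
    have hAA : A⁻¹ * (A * A) * A⁻¹ = 1 := by
      rw [Matrix.nonsing_inv_mul_cancel_left _ _ hAu, Matrix.mul_nonsing_inv _ hAu]
    have hCC : C * Cᴴ = 1 - A * A := by rw [hAC, sub_sub_cancel]
    rw [Matrix.conjTranspose_neg, Matrix.neg_mul, Matrix.mul_neg, neg_neg, Matrix.conjTranspose_mul,
      Matrix.conjTranspose_conjTranspose, hinv.isHermitian.eq, Matrix.mul_assoc,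
      ← Matrix.mul_assoc C, hCC, Matrix.sub_mul, Matrix.mul_sub, ← Matrix.mul_assoc A⁻¹ (A * A),
      hAA, Matrix.one_mul, add_sub_cancel]
  rw [quadratisation_eq, hK, dilation, CFC.sqrt_unique hsq hinv.nonneg, hu,
    Matrix.nonsing_inv_mul_cancel_left _ _ hAu]

theorem exists_eq_mul_padZero_quadratisation (h : N < M) {X : Matrix (Fin M) (Fin N) 𝕜}
    (hX : (upperBlock h X).det ≠ 0) :
    ∃ W ∈ Matrix.unitaryGroup (Fin M) 𝕜,
      HasCanonicalForm h W ∧ X = W * padZero h (quadratisation h X) := by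
  set K := lowerBlock h X * (upperBlock h X)⁻¹ with hK
  set H := dilation K with hH
  have hHu : IsUnit H.det := (det_dilation_ne_zero K).isUnit
  have hHps : H.PosSemidef := posSemidef_dilation K
  have hinv : (H⁻¹).PosSemidef := hHps.inv
  have hinvh : (H⁻¹)ᴴ = H⁻¹ := hinv.isHermitian
  -- The choice forced by `A = H⁻¹` and `K = -C† A⁻¹`.
  set C : Matrix (Fin N) (Fin (M - N)) 𝕜 := -(K * H⁻¹)ᴴ with hC
  have hKK : Kᴴ * K = H * H - 1 := by rw [hH, dilation_mul_self, add_sub_cancel_left]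
  have hAC : H⁻¹ * H⁻¹ = 1 - C * Cᴴ := by
    have hAA : H⁻¹ * (H * H) * H⁻¹ = 1 := by
      rw [Matrix.nonsing_inv_mul_cancel_left _ _ hHu, Matrix.mul_nonsing_inv _ hHu]
    rw [hC, Matrix.conjTranspose_neg, Matrix.neg_mul, Matrix.mul_neg, neg_neg,
      Matrix.conjTranspose_conjTranspose,
      Matrix.conjTranspose_mul, hinvh, Matrix.mul_assoc, ← Matrix.mul_assoc Kᴴ, hKK,
      Matrix.sub_mul, Matrix.mul_sub, ← Matrix.mul_assoc H⁻¹ (H * H), hAA, Matrix.one_mul,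
      sub_sub_cancel]
  have hps : (1 - C * Cᴴ).PosSemidef := by
    rw [← hAC]
    nth_rewrite 1 [← hinvh]
    exact Matrix.posSemidef_conjTranspose_mul_self _
  have hps' : (1 - Cᴴ * C).PosSemidef := posSemidef_one_sub_conjTranspose_mul_self hps
  have hD : (CFC.sqrt (1 - Cᴴ * C)).PosSemidef := Matrix.nonneg_iff_posSemidef.1 (CFC.sqrt_nonneg _)
  have hDC := CFC.sqrt_mul_sqrt_self _ hps'.nonneg
  have hinvu : IsUnit (H⁻¹).det := by
    rw [Matrix.det_nonsing_inv]; exact hHu.ringInverse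
  refine ⟨_, reindex_mem_unitaryGroup (rowEquiv h)
    (fromBlocks_mem_unitaryGroup hinv hinvu hAC hD hDC),
    ⟨C, H⁻¹, _, hinv, hAC, hD, hDC, rfl⟩, ?_⟩
  rw [eq_reindex_mul_padZero_iff, quadratisation_eq, ← hK, ← hH]
  refine ⟨(Matrix.nonsing_inv_mul_cancel_left _ _ hHu).symm, ?_⟩
  rw [hC, Matrix.conjTranspose_neg, neg_neg, Matrix.conjTranspose_conjTranspose, Matrix.mul_assoc,
    Matrix.nonsing_inv_mul_cancel_left _ _ hHu, hK,
    Matrix.nonsing_inv_mul_cancel_right _ _ hX.isUnit]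

theorem exists_eq_mul_padZero_iff (h : N < M) {X : Matrix (Fin M) (Fin N) 𝕜}
    (hX : (upperBlock h X).det ≠ 0) (G : Matrix (Fin N) (Fin N) 𝕜) :
    (∃ W ∈ Matrix.unitaryGroup (Fin M) 𝕜, HasCanonicalForm h W ∧ X = W * padZero h G) ↔
      G = quadratisation h X := by
  constructor
  · rintro ⟨W, -, hW, hG⟩
    exact eq_quadratisation_of_eq_mul_padZero h hX hW hG
  · rintro rfl
    exact exists_eq_mul_padZero_quadratisation h hX

end Blocks

/-! ### Measurability of the quadratisation. -/

section Measurability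

variable {𝕜 : Type*} [RCLike 𝕜] [MeasurableSpace 𝕜] [BorelSpace 𝕜] {l m n : ℕ}

instance instBorelSpaceMatrix : BorelSpace (Matrix (Fin m) (Fin n) 𝕜) :=
  inferInstanceAs (BorelSpace (Fin m → Fin n → 𝕜))

instance instSecondCountableTopologyMatrix :
    SecondCountableTopology (Matrix (Fin m) (Fin n) 𝕜) :=
  inferInstanceAs (SecondCountableTopology (Fin m → Fin n → 𝕜))

instance instStandardBorelSpaceMatrix : StandardBorelSpace (Matrix (Fin m) (Fin n) 𝕜) :=
  inferInstanceAs (StandardBorelSpace (Fin m → Fin n → 𝕜))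

theorem measurable_matrix_mul :
    Measurable fun p : Matrix (Fin l) (Fin m) 𝕜 × Matrix (Fin m) (Fin n) 𝕜 => p.1 * p.2 :=
  (continuous_fst.matrix_mul continuous_snd).measurable

theorem measurable_matrix_det : Measurable fun A : Matrix (Fin n) (Fin n) 𝕜 => A.det :=
  continuous_id.matrix_det.measurable

theorem measurable_matrix_inv : Measurable fun A : Matrix (Fin n) (Fin n) 𝕜 => A⁻¹ := by
  have : (fun A : Matrix (Fin n) (Fin n) 𝕜 => A⁻¹) = fun A => A.det⁻¹ • A.adjugate := by
    ext1 A
    rw [Matrix.inv_def, Ring.inverse_eq_inv']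
  rw [this]
  exact measurable_matrix_det.inv.smul continuous_id.matrix_adjugate.measurable

/-- Squaring is a measurable embedding of the positive semidefinite matrices. -/
theorem measurableEmbedding_mul_self_posSemidef :
    MeasurableEmbedding
      fun T : {T : Matrix (Fin n) (Fin n) 𝕜 // 0 ≤ T} => (T : Matrix (Fin n) (Fin n) 𝕜) * T := by
  have hmeas : MeasurableSet {T : Matrix (Fin n) (Fin n) 𝕜 | 0 ≤ T} := by
    have : {T : Matrix (Fin n) (Fin n) 𝕜 | 0 ≤ T} =
        {T | Tᴴ = T} ∩ ⋂ x : Fin n → 𝕜, {T | 0 ≤ star x ⬝ᵥ (T *ᵥ x)} := by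
      ext T
      simp [Matrix.nonneg_iff_posSemidef, Matrix.posSemidef_iff_dotProduct_mulVec, Matrix.IsHermitian]
    rw [this]
    refine IsClosed.measurableSet (IsClosed.inter ?_ (isClosed_iInter fun x => ?_))
    · exact isClosed_eq continuous_id.matrix_conjTranspose continuous_id
    · exact isClosed_le continuous_const
        (continuous_const.dotProduct (continuous_id.matrix_mulVec continuous_const))
  have : StandardBorelSpace {T : Matrix (Fin n) (Fin n) 𝕜 // 0 ≤ T} := hmeas.standardBorel
  -- Lusin–Souslin: an injective measurable map out of a standard Borel space is an embedding.
  -- Injectivity is uniqueness of the positive square root.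
  refine Measurable.measurableEmbedding ?_ ?_
  · exact measurable_matrix_mul.comp (measurable_subtype_coe.prodMk measurable_subtype_coe)
  · intro S T hST
    have hS := CFC.sqrt_unique (rfl : (S : Matrix (Fin n) (Fin n) 𝕜) * S = _) S.2
    have hT := CFC.sqrt_unique (rfl : (T : Matrix (Fin n) (Fin n) 𝕜) * T = _) T.2
    exact Subtype.ext (hS.symm.trans ((congrArg CFC.sqrt hST).trans hT))

/-- Continuity of the square root is avoided: the square `1 + K†K` is continuous in `K`, and
squaring is a measurable embedding. -/
theorem measurable_dilation :
    Measurable fun K : Matrix (Fin m) (Fin n) 𝕜 => dilation K := by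
  have h : Measurable fun K : Matrix (Fin m) (Fin n) 𝕜 =>
      (⟨dilation K, CFC.sqrt_nonneg _⟩ : {T : Matrix (Fin n) (Fin n) 𝕜 // 0 ≤ T}) := by
    rw [← measurableEmbedding_mul_self_posSemidef.measurable_comp_iff]
    have : (fun T : {T : Matrix (Fin n) (Fin n) 𝕜 // 0 ≤ T} =>
        (T : Matrix (Fin n) (Fin n) 𝕜) * T) ∘
        (fun K : Matrix (Fin m) (Fin n) 𝕜 => ⟨dilation K, CFC.sqrt_nonneg _⟩) =
        fun K => 1 + Kᴴ * K := by
      ext1 K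
      exact dilation_mul_self K
    rw [this]
    exact (continuous_const.add
      (continuous_id.matrix_conjTranspose.matrix_mul continuous_id)).measurable
  exact measurable_subtype_coe.comp h

theorem measurable_upperBlock {M N : ℕ} (h : N < M) :
    Measurable fun X : Matrix (Fin M) (Fin N) 𝕜 => upperBlock h X :=
  (continuous_id.matrix_submatrix _ _).measurable

theorem measurable_lowerBlock {M N : ℕ} (h : N < M) :
    Measurable fun X : Matrix (Fin M) (Fin N) 𝕜 => lowerBlock h X :=
  (continuous_id.matrix_submatrix _ _).measurable

theorem measurable_quadratisation {M N : ℕ} (h : N < M) :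
    Measurable fun X : Matrix (Fin M) (Fin N) 𝕜 => quadratisation h X := by
  simp_rw [quadratisation_eq]
  refine measurable_matrix_mul.comp (Measurable.prodMk (measurable_dilation.comp ?_)
    (measurable_upperBlock h))
  exact measurable_matrix_mul.comp ((measurable_lowerBlock h).prodMk
    (measurable_matrix_inv.comp (measurable_upperBlock h)))

end Measurability

/-! ### Jacobians of `𝕜`-linear maps. -/

section LinearMap

variable {𝕜 : Type*} [RCLike 𝕜] {m n : ℕ}

/-- The hypothesis `hb` treats both fields at once: `b` is 1 over `ℝ` and 2 over `ℂ`, so `b` plays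
the role of `β`. -/
theorem lintegral_comp_linearMap {E : Type*} [NormedAddCommGroup E] [NormedSpace ℝ E]
    [NormedSpace 𝕜 E] [IsScalarTower ℝ 𝕜 E] [FiniteDimensional ℝ E] [MeasurableSpace E]
    [BorelSpace E] (μ : Measure E) [μ.IsAddHaarMeasure]
    {b : ℕ} (hb : ∀ x : 𝕜, |Algebra.norm ℝ x| = ‖x‖ ^ b)
    {f : E →ₗ[𝕜] E} (hf : LinearMap.det f ≠ 0) {g : E → ℝ≥0∞} (hg : Measurable g) :
    ∫⁻ x, g (f x) ∂μ = ENNReal.ofReal (‖LinearMap.det f‖ ^ b)⁻¹ * ∫⁻ x, g x ∂μ := by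
  have habs : |LinearMap.det (f.restrictScalars ℝ)| = ‖LinearMap.det f‖ ^ b := by
    rw [LinearMap.det_restrictScalars, hb]
  have hdet : LinearMap.det (f.restrictScalars ℝ) ≠ 0 := by
    rw [← abs_pos, habs]
    exact pow_pos (norm_pos_iff.2 hf) _
  have hfm : Measurable (f.restrictScalars ℝ) :=
    (LinearMap.continuous_of_finiteDimensional (f.restrictScalars ℝ)).measurable
  have hmap := Measure.map_linearMap_addHaar_eq_smul_addHaar μ hdet
  rw [abs_inv, habs] at hmap
  have := lintegral_map (μ := μ) hg hfm
  rw [hmap, lintegral_smul_measure] at this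
  exact this.symm

/-- Right multiplication acts separately on each of the `m` rows. -/
theorem det_matrix_mulRight (P : Matrix (Fin n) (Fin n) 𝕜) :
    LinearMap.det (LinearMap.pi fun i : Fin m => P.vecMulLinear ∘ₗ LinearMap.proj i :
      (Fin m → Fin n → 𝕜) →ₗ[𝕜] (Fin m → Fin n → 𝕜)) = P.det ^ m := by
  rw [LinearMap.det_pi, Finset.prod_const, Finset.card_univ, Fintype.card_fin]
  congr 1
  rw [← Matrix.det_transpose, ← LinearMap.det_toLin']
  congr 1
  refine LinearMap.ext fun v => ?_
  rw [Matrix.toLin'_apply, Matrix.mulVec_transpose, Matrix.vecMulLinear_apply]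

end LinearMap

/-! ### Lebesgue measure on matrices. -/

section Lebesgue

theorem measurePreserving_blocks {𝕜 : Type*} [MeasureSpace 𝕜]
    [SigmaFinite (volume : Measure 𝕜)] {M N : ℕ} (h : N < M) :
    MeasurePreserving (fun X : Matrix (Fin M) (Fin N) 𝕜 => (upperBlock h X, lowerBlock h X))
      (lebesgue M N 𝕜) ((lebesgue N N 𝕜).prod (lebesgue (M - N) N 𝕜)) := by
  have h1 := (measurePreserving_piCongrLeft (α := fun _ : Fin M => Fin N → 𝕜)
    (fun _ => Measure.pi fun _ : Fin N => (volume : Measure 𝕜)) (rowEquiv h)).symm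
  have h2 := measurePreserving_sumPiEquivProdPi (X := fun _ : Fin N ⊕ Fin (M - N) => Fin N → 𝕜)
    (fun _ => Measure.pi fun _ : Fin N => (volume : Measure 𝕜))
  exact h2.comp h1

variable {𝕜 : Type*} [RCLike 𝕜] [MeasureSpace 𝕜] [BorelSpace 𝕜]
  [(volume : Measure 𝕜).IsAddHaarMeasure] {m n : ℕ}

instance instSigmaFiniteLebesgue : SigmaFinite (lebesgue m n 𝕜) := by
  have : SigmaFinite (Measure.pi fun _ : Fin n => (volume : Measure 𝕜)) := inferInstance
  have : SigmaFinite (Measure.pi fun _ : Fin m =>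
    Measure.pi fun _ : Fin n => (volume : Measure 𝕜)) := inferInstance
  exact this

instance instIsAddHaarMeasureLebesgue : (lebesgue m n 𝕜).IsAddHaarMeasure := by
  have : SigmaFinite (Measure.pi fun _ : Fin n => (volume : Measure 𝕜)) := inferInstance
  have : (Measure.pi fun _ : Fin n => (volume : Measure 𝕜)).IsAddHaarMeasure := inferInstance
  have : (Measure.pi fun _ : Fin m =>
    Measure.pi fun _ : Fin n => (volume : Measure 𝕜)).IsAddHaarMeasure := inferInstance
  exact this

theorem lintegral_lebesgue_comp_linearMap {b : ℕ} (hb : ∀ x : 𝕜, |Algebra.norm ℝ x| = ‖x‖ ^ b)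
    {f : Matrix (Fin m) (Fin n) 𝕜 →ₗ[𝕜] Matrix (Fin m) (Fin n) 𝕜} (hf : LinearMap.det f ≠ 0)
    {g : Matrix (Fin m) (Fin n) 𝕜 → ℝ≥0∞} (hg : Measurable g) :
    ∫⁻ X, g (f X) ∂lebesgue m n 𝕜 =
      ENNReal.ofReal (‖LinearMap.det f‖ ^ b)⁻¹ * ∫⁻ X, g X ∂lebesgue m n 𝕜 := by
  have : (Measure.pi fun _ : Fin m =>
    Measure.pi fun _ : Fin n => (volume : Measure 𝕜)).IsAddHaarMeasure :=
    instIsAddHaarMeasureLebesgue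
  exact lintegral_comp_linearMap (E := Fin m → Fin n → 𝕜)
    (Measure.pi fun _ : Fin m => Measure.pi fun _ : Fin n => (volume : Measure 𝕜)) hb hf hg

theorem lintegral_lebesgue_mul_right {b : ℕ} (hb : ∀ x : 𝕜, |Algebra.norm ℝ x| = ‖x‖ ^ b)
    {P : Matrix (Fin n) (Fin n) 𝕜} (hP : P.det ≠ 0)
    {g : Matrix (Fin m) (Fin n) 𝕜 → ℝ≥0∞} (hg : Measurable g) :
    ∫⁻ X, g (X * P) ∂lebesgue m n 𝕜 =
      ENNReal.ofReal (‖P.det‖ ^ (b * m))⁻¹ * ∫⁻ X, g X ∂lebesgue m n 𝕜 := by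
  have hdet := det_matrix_mulRight (m := m) P
  have := lintegral_lebesgue_comp_linearMap (m := m) (n := n) hb
    (f := (LinearMap.pi fun i : Fin m => P.vecMulLinear ∘ₗ LinearMap.proj i :
      (Fin m → Fin n → 𝕜) →ₗ[𝕜] (Fin m → Fin n → 𝕜))) (hdet ▸ pow_ne_zero _ hP) hg
  rw [mul_comm b m, pow_mul, ← norm_pow, ← hdet]
  exact this

theorem lintegral_lebesgue_mul_left {b : ℕ} (hb : ∀ x : 𝕜, |Algebra.norm ℝ x| = ‖x‖ ^ b)
    {P : Matrix (Fin m) (Fin m) 𝕜} (hP : P.det ≠ 0)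
    {g : Matrix (Fin m) (Fin n) 𝕜 → ℝ≥0∞} (hg : Measurable g) :
    ∫⁻ X, g (P * X) ∂lebesgue m n 𝕜 =
      ENNReal.ofReal (‖P.det‖ ^ (b * n))⁻¹ * ∫⁻ X, g X ∂lebesgue m n 𝕜 := by
  let f : Matrix (Fin n) (Fin m) 𝕜 →ₗ[𝕜] Matrix (Fin n) (Fin m) 𝕜 :=
    (LinearMap.pi fun i : Fin n => Pᵀ.vecMulLinear ∘ₗ LinearMap.proj i :
      (Fin n → Fin m → 𝕜) →ₗ[𝕜] (Fin n → Fin m → 𝕜))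
  let e := Matrix.transposeLinearEquiv (Fin n) (Fin m) 𝕜 𝕜
  -- Left multiplication by `P` is right multiplication by `Pᵀ` conjugated by transposition.
  have hdet : LinearMap.det (e.toLinearMap ∘ₗ f ∘ₗ e.symm.toLinearMap) = P.det ^ n := by
    rw [LinearMap.det_conj, ← Matrix.det_transpose P]
    exact det_matrix_mulRight Pᵀ
  have := lintegral_lebesgue_comp_linearMap hb (hdet ▸ pow_ne_zero _ hP) hg
  rw [hdet, norm_pow, ← pow_mul, mul_comm n b] at this
  rw [← this]
  refine lintegral_congr fun X => congrArg g ?_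
  have hX : f Xᵀ = Xᵀ * Pᵀ := rfl
  change P * X = (f Xᵀ)ᵀ
  rw [hX, ← Matrix.transpose_mul, Matrix.transpose_transpose]

/-- For each `Y`, the matrix `Y - t` is singular for finitely many real `t` only. By Fubini some `t`
makes `Y - t` invertible for almost every `Y`, and translation invariance removes `t`. -/
theorem ae_det_ne_zero : ∀ᵐ Y ∂lebesgue n n 𝕜, Y.det ≠ 0 := by
  have hmeas : MeasurableSet {Y : Matrix (Fin n) (Fin n) 𝕜 | Y.det ≠ 0} :=
    (measurable_matrix_det (measurableSet_singleton 0)).compl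
  have hsub : Measurable fun p : Matrix (Fin n) (Fin n) 𝕜 × ℝ =>
      p.1 - Matrix.scalar (Fin n) (p.2 : 𝕜) := by
    refine Continuous.measurable (continuous_fst.sub ?_)
    exact (continuous_pi fun _ => RCLike.continuous_ofReal.comp continuous_snd).matrix_diagonal
  have hset : MeasurableSet {p : Matrix (Fin n) (Fin n) 𝕜 × ℝ |
      (p.1 - Matrix.scalar (Fin n) (p.2 : 𝕜)).det ≠ 0} := hsub hmeas
  have hae : ∀ Y : Matrix (Fin n) (Fin n) 𝕜,
      ∀ᵐ t : ℝ, (Y - Matrix.scalar (Fin n) (t : 𝕜)).det ≠ 0 := by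
    intro Y
    have hroots : {x : 𝕜 | Y.charpoly.IsRoot x}.Finite :=
      Polynomial.finite_setOfPred_isRoot Y.charpoly_monic.ne_zero
    have hfin : {t : ℝ | (Y - Matrix.scalar (Fin n) (t : 𝕜)).det = 0}.Finite := by
      refine (hroots.preimage (f := fun t : ℝ => (t : 𝕜)) RCLike.ofReal_injective.injOn).subset ?_
      intro t ht
      change Y.charpoly.eval (t : 𝕜) = 0
      rw [Matrix.eval_charpoly, ← neg_sub, Matrix.det_neg, show _ = (0 : 𝕜) from ht, mul_zero]
    rw [ae_iff]
    simpa using hfin.measure_zero volume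
  have hcomm := (Measure.ae_ae_comm (μ := lebesgue n n 𝕜) (ν := (volume : Measure ℝ)) hset).1
    (Filter.Eventually.of_forall hae)
  obtain ⟨t, ht⟩ := hcomm.exists
  have := (measurePreserving_add_right (lebesgue n n 𝕜)
    (Matrix.scalar (Fin n) (t : 𝕜))).quasiMeasurePreserving.ae ht
  simpa using this

end Lebesgue

/-- Comparing total masses makes `c` cancel. Being a probability measure excludes masses `0` and
`∞`, so `c` need not be known to be finite beforehand. -/
theorem map_normalizedWithDensity {α γ : Type*} [MeasurableSpace α] [MeasurableSpace γ]
    {μ : Measure α} {ν : Measure γ} {f : α → ℝ≥0∞} {g : γ → ℝ≥0∞} {Q : α → γ} (hQ : Measurable Q)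
    {c : ℝ≥0∞} (hmap : (μ.withDensity f).map Q = c • ν.withDensity g)
    (hprob : IsProbabilityMeasure (normalizedWithDensity μ f)) :
    (normalizedWithDensity μ f).map Q = normalizedWithDensity ν g := by
  have hmass : ∫⁻ x, f x ∂μ = c * ∫⁻ y, g y ∂ν := by
    have := congrArg (fun ρ : Measure γ => ρ Set.univ) hmap
    simpa [Measure.map_apply hQ, withDensity_apply] using this
  have hone : (∫⁻ x, f x ∂μ)⁻¹ * ∫⁻ x, f x ∂μ = 1 := by
    have := hprob.measure_univ
    simpa [normalizedWithDensity, withDensity_apply] using this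
  have h0 : ∫⁻ x, f x ∂μ ≠ 0 := by
    intro h
    simp [h] at hone
  have htop : ∫⁻ x, f x ∂μ ≠ ∞ := by
    intro h
    simp [h] at hone
  rw [hmass] at h0 htop
  have hc0 := left_ne_zero_of_mul h0
  have hg0 := right_ne_zero_of_mul h0
  have hct : c ≠ ∞ := fun h => htop (by rw [h, ENNReal.top_mul hg0])
  rw [normalizedWithDensity, normalizedWithDensity, Measure.map_smul, hmap, smul_smul, hmass,
    ENNReal.mul_inv (Or.inl hc0) (Or.inl hct), mul_assoc, mul_comm _ c, ← mul_assoc,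
    ENNReal.inv_mul_cancel hc0 hct, one_mul]

/-! ### Gram matrices and densities. -/

section Gram

variable {𝕜 : Type*} [RCLike 𝕜] {M N : ℕ}

theorem conjTranspose_mul_self_quadratisation (h : N < M) {X : Matrix (Fin M) (Fin N) 𝕜}
    (hX : (upperBlock h X).det ≠ 0) :
    (quadratisation h X)ᴴ * quadratisation h X = Xᴴ * X := by
  obtain ⟨W, hW, -, hXW⟩ := exists_eq_mul_padZero_quadratisation h hX
  have hpad : (padZero h (quadratisation h X))ᴴ * padZero h (quadratisation h X) =
      (quadratisation h X)ᴴ * quadratisation h X := by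
    rw [padZero, Matrix.conjTranspose_submatrix, Matrix.submatrix_mul_equiv,
      Matrix.conjTranspose_fromRows_eq_fromCols_conjTranspose, Matrix.fromCols_mul_fromRows]
    simp
  rw [Matrix.mem_unitaryGroup_iff', Matrix.star_eq_conjTranspose] at hW
  conv_rhs => rw [hXW]
  rw [Matrix.conjTranspose_mul, Matrix.mul_assoc, ← Matrix.mul_assoc Wᴴ, hW, Matrix.one_mul, hpad]

theorem re_det_conjTranspose_mul_self_rpow (G : Matrix (Fin N) (Fin N) 𝕜) (b L : ℕ) :
    (RCLike.re (Gᴴ * G).det) ^ ((b : ℝ) / 2 * L) = ‖G.det‖ ^ (b * L) := by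
  rw [Matrix.det_mul, Matrix.det_conjTranspose, RCLike.star_def, RCLike.conj_mul,
    ← RCLike.ofReal_pow, RCLike.ofReal_re, ← Real.rpow_natCast, ← Real.rpow_mul (norm_nonneg _),
    ← Real.rpow_natCast]
  congr 1
  push_cast
  ring

theorem measurable_exp_trace [MeasurableSpace 𝕜] [BorelSpace 𝕜] (m n : ℕ) (a : ℝ) :
    Measurable fun X : Matrix (Fin m) (Fin n) 𝕜 =>
      ENNReal.ofReal (Real.exp (a * RCLike.re (Xᴴ * X).trace)) := by
  refine Continuous.measurable ?_
  refine ENNReal.continuous_ofReal.comp (Real.continuous_exp.comp (continuous_const.mul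
    (RCLike.continuous_re.comp (Continuous.matrix_trace ?_))))
  exact continuous_id.matrix_conjTranspose.matrix_mul continuous_id

end Gram

section MeasurableProducts

variable {𝕜 : Type*} [RCLike 𝕜] [MeasurableSpace 𝕜] [BorelSpace 𝕜] {α : Type*} [MeasurableSpace α]

theorem measurable_dilation_mul {L N : ℕ} {Y : α → Matrix (Fin N) (Fin N) 𝕜}
    {K : α → Matrix (Fin L) (Fin N) 𝕜} (hY : Measurable Y) (hK : Measurable K) :
    Measurable fun a => dilation (K a) * Y a :=
  measurable_matrix_mul.comp ((measurable_dilation.comp hK).prodMk hY)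

theorem measurable_mul_inv {L N : ℕ} {Y : α → Matrix (Fin N) (Fin N) 𝕜}
    {Z : α → Matrix (Fin L) (Fin N) 𝕜} (hY : Measurable Y) (hZ : Measurable Z) :
    Measurable fun a => Z a * (Y a)⁻¹ :=
  measurable_matrix_mul.comp (hZ.prodMk (measurable_matrix_inv.comp hY))

end MeasurableProducts

/-! ### The law of the quadratisation. -/

section Law

variable {𝕜 : Type*} [RCLike 𝕜] [MeasureSpace 𝕜] [BorelSpace 𝕜]
  [(volume : Measure 𝕜).IsAddHaarMeasure] {M N : ℕ}

/-- Substitute `G = H Y`: the first constant comes from `|det Y| = |det H|⁻¹ |det G|`, the second is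
the Jacobian of left multiplication by `H`. -/
theorem lintegral_dilation_mul {b L : ℕ} (hb : ∀ x : 𝕜, |Algebra.norm ℝ x| = ‖x‖ ^ b)
    (K : Matrix (Fin L) (Fin N) 𝕜) {f : Matrix (Fin N) (Fin N) 𝕜 → ℝ≥0∞} (hf : Measurable f) :
    ∫⁻ Y, ENNReal.ofReal (‖Y.det‖ ^ (b * L)) * f (dilation K * Y) ∂lebesgue N N 𝕜 =
      ENNReal.ofReal (‖(dilation K).det‖ ^ (b * L))⁻¹ *
        ENNReal.ofReal (‖(dilation K).det‖ ^ (b * N))⁻¹ *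
          ∫⁻ G, f G * ENNReal.ofReal (‖G.det‖ ^ (b * L)) ∂lebesgue N N 𝕜 := by
  have hK := det_dilation_ne_zero K
  generalize dilation K = H at hK ⊢
  have hpos : 0 < ‖H.det‖ ^ (b * L) := pow_pos (norm_pos_iff.2 hK) _
  have hfw : Measurable fun G : Matrix (Fin N) (Fin N) 𝕜 =>
      f G * ENNReal.ofReal (‖G.det‖ ^ (b * L)) :=
    hf.mul (measurable_matrix_det.norm.pow_const _).ennreal_ofReal
  have hHm : Measurable fun Y : Matrix (Fin N) (Fin N) 𝕜 => H * Y :=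
    measurable_matrix_mul.comp (measurable_const.prodMk measurable_id)
  have hweight : ∀ Y : Matrix (Fin N) (Fin N) 𝕜,
      ENNReal.ofReal (‖Y.det‖ ^ (b * L)) * f (H * Y) =
        ENNReal.ofReal (‖H.det‖ ^ (b * L))⁻¹ *
          (f (H * Y) * ENNReal.ofReal (‖(H * Y).det‖ ^ (b * L))) := by
    intro Y
    rw [mul_left_comm, ← ENNReal.ofReal_mul (inv_nonneg.2 hpos.le), Matrix.det_mul, norm_mul,
      mul_pow, inv_mul_cancel_left₀ hpos.ne', mul_comm]
  have hHfw : Measurable fun Y : Matrix (Fin N) (Fin N) 𝕜 =>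
      f (H * Y) * ENNReal.ofReal (‖(H * Y).det‖ ^ (b * L)) := hfw.comp hHm
  rw [lintegral_congr hweight, lintegral_const_mul _ hHfw,
    lintegral_lebesgue_mul_left hb hK hfw, mul_assoc]

/-- This Jacobian is the source of the determinant weight in the induced Ginibre density. -/
theorem lintegral_comp_mul_inv {b L : ℕ} (hb : ∀ x : 𝕜, |Algebra.norm ℝ x| = ‖x‖ ^ b)
    {Y : Matrix (Fin N) (Fin N) 𝕜} (hY : Y.det ≠ 0)
    {g : Matrix (Fin L) (Fin N) 𝕜 → ℝ≥0∞} (hg : Measurable g) :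
    ∫⁻ Z, g (Z * Y⁻¹) ∂lebesgue L N 𝕜 =
      ENNReal.ofReal (‖Y.det‖ ^ (b * L)) * ∫⁻ K, g K ∂lebesgue L N 𝕜 := by
  have hY' : (Y⁻¹).det ≠ 0 := by
    rw [Matrix.det_nonsing_inv, Ring.inverse_eq_inv']
    exact inv_ne_zero hY
  rw [lintegral_lebesgue_mul_right hb hY' hg, Matrix.det_nonsing_inv, Ring.inverse_eq_inv',
    norm_inv, inv_pow, inv_inv]

/-- Tonelli is used twice: integrate over `Z` first to pass to `K`, then over `Y` at fixed `K` to
pass to `G`; the variables `K` and `G` separate. -/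
theorem lintegral_dilation_mul_inv_mul {b L : ℕ} (hb : ∀ x : 𝕜, |Algebra.norm ℝ x| = ‖x‖ ^ b)
    {f : Matrix (Fin N) (Fin N) 𝕜 → ℝ≥0∞} (hf : Measurable f) :
    ∫⁻ p, f (dilation (p.2 * p.1⁻¹) * p.1) ∂(lebesgue N N 𝕜).prod (lebesgue L N 𝕜) =
      (∫⁻ K, ENNReal.ofReal (‖(dilation K).det‖ ^ (b * L))⁻¹ *
        ENNReal.ofReal (‖(dilation K).det‖ ^ (b * N))⁻¹ ∂lebesgue L N 𝕜) *
      ∫⁻ G, f G * ENNReal.ofReal (‖G.det‖ ^ (b * L)) ∂lebesgue N N 𝕜 := by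
  have hw : Measurable fun Y : Matrix (Fin N) (Fin N) 𝕜 =>
      ENNReal.ofReal (‖Y.det‖ ^ (b * L)) :=
    (measurable_matrix_det.norm.pow_const _).ennreal_ofReal
  have hfd : Measurable fun p : Matrix (Fin N) (Fin N) 𝕜 × Matrix (Fin L) (Fin N) 𝕜 =>
      f (dilation p.2 * p.1) := hf.comp (measurable_dilation_mul measurable_fst measurable_snd)
  have hfi : Measurable fun p : Matrix (Fin N) (Fin N) 𝕜 × Matrix (Fin L) (Fin N) 𝕜 =>
      f (dilation (p.2 * p.1⁻¹) * p.1) := hf.comp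
      (measurable_dilation_mul measurable_fst (measurable_mul_inv measurable_fst measurable_snd))
  have hsubst : ∀ᵐ Y ∂lebesgue N N 𝕜,
      ∫⁻ Z, f (dilation (Z * Y⁻¹) * Y) ∂lebesgue L N 𝕜 =
        ∫⁻ K, ENNReal.ofReal (‖Y.det‖ ^ (b * L)) * f (dilation K * Y) ∂lebesgue L N 𝕜 := by
    refine ae_det_ne_zero.mono fun Y hY => ?_
    have hg : Measurable fun K : Matrix (Fin L) (Fin N) 𝕜 => f (dilation K * Y) :=
      hf.comp (measurable_dilation_mul measurable_const measurable_id)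
    rw [lintegral_const_mul _ hg, ← lintegral_comp_mul_inv hb hY hg]
  have hwfd : Measurable fun p : Matrix (Fin N) (Fin N) 𝕜 × Matrix (Fin L) (Fin N) 𝕜 =>
      ENNReal.ofReal (‖p.1.det‖ ^ (b * L)) * f (dilation p.2 * p.1) :=
    (hw.comp measurable_fst).mul hfd
  have hd : Measurable fun K : Matrix (Fin L) (Fin N) 𝕜 => ‖(dilation K).det‖ :=
    (measurable_matrix_det.comp measurable_dilation).norm
  rw [lintegral_prod _ hfi.aemeasurable, lintegral_congr_ae hsubst,
    lintegral_lintegral_swap hwfd.aemeasurable,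
    lintegral_congr fun K => lintegral_dilation_mul hb K hf]
  exact lintegral_mul_const _
    ((hd.pow_const _).inv.ennreal_ofReal.mul (hd.pow_const _).inv.ennreal_ofReal)

/-- The image of Lebesgue measure under the quadratisation. -/
theorem lintegral_quadratisation {b : ℕ} (hb : ∀ x : 𝕜, |Algebra.norm ℝ x| = ‖x‖ ^ b)
    (h : N < M) {f : Matrix (Fin N) (Fin N) 𝕜 → ℝ≥0∞} (hf : Measurable f) :
    ∫⁻ X, f (quadratisation h X) ∂lebesgue M N 𝕜 =
      (∫⁻ K, ENNReal.ofReal (‖(dilation K).det‖ ^ (b * (M - N)))⁻¹ *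
        ENNReal.ofReal (‖(dilation K).det‖ ^ (b * N))⁻¹ ∂lebesgue (M - N) N 𝕜) *
      ∫⁻ G, f G * ENNReal.ofReal (‖G.det‖ ^ (b * (M - N))) ∂lebesgue N N 𝕜 := by
  rw [← lintegral_dilation_mul_inv_mul hb hf, lintegral_congr fun X => congrArg f
    (quadratisation_eq h X)]
  exact (measurePreserving_blocks (𝕜 := 𝕜) h).lintegral_comp
    (hf.comp
      (measurable_dilation_mul measurable_fst (measurable_mul_inv measurable_fst measurable_snd)))

theorem ae_det_upperBlock_ne_zero (h : N < M) :
    ∀ᵐ X ∂lebesgue M N 𝕜, (upperBlock h X).det ≠ 0 := by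
  have h1 : ∀ᵐ p ∂(lebesgue N N 𝕜).prod (lebesgue (M - N) N 𝕜), p.1.det ≠ 0 :=
    Measure.quasiMeasurePreserving_fst.ae ae_det_ne_zero
  exact (measurePreserving_blocks (𝕜 := 𝕜) h).quasiMeasurePreserving.ae h1

theorem map_quadratisation_gaussianMatrix {b : ℕ}
    (hb : ∀ x : 𝕜, |Algebra.norm ℝ x| = ‖x‖ ^ b) (h : N < M)
    (hprob : IsProbabilityMeasure (gaussianMatrix M N 𝕜 b)) :
    (gaussianMatrix M N 𝕜 b).map (quadratisation h) = inducedGinibre N ((M : ℝ) - N) 𝕜 b := by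
  refine map_normalizedWithDensity (measurable_quadratisation h)
    (c := ∫⁻ K, ENNReal.ofReal (‖(dilation K).det‖ ^ (b * (M - N)))⁻¹ *
        ENNReal.ofReal (‖(dilation K).det‖ ^ (b * N))⁻¹ ∂lebesgue (M - N) N 𝕜) ?_ hprob
  ext s hs
  have hexp := measurable_exp_trace (𝕜 := 𝕜) N N (-((b : ℝ) / 2))
  rw [Measure.map_apply (measurable_quadratisation h) hs,
    withDensity_apply _ (measurable_quadratisation h hs), Measure.smul_apply,
    withDensity_apply _ hs, ← lintegral_indicator (measurable_quadratisation h hs),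
    ← lintegral_indicator hs, smul_eq_mul]
  refine Eq.trans ?_ ((lintegral_quadratisation hb h (hexp.indicator hs)).trans ?_)
  -- Almost everywhere `X†X = G†G`, so the Gaussian weight of `X` is that of `G`.
  · refine lintegral_congr_ae ((ae_det_upperBlock_ne_zero h).mono fun X hX => ?_)
    simp only [Set.indicator, Set.mem_preimage, conjTranspose_mul_self_quadratisation h hX]
    rfl
  · congr 1
    refine lintegral_congr fun G => ?_
    rw [Set.indicator, Set.indicator]
    split_ifs
    · rw [← Nat.cast_sub h.le, re_det_conjTranspose_mul_self_rpow, mul_comm,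
        ENNReal.ofReal_mul (by positivity)]
    · rw [zero_mul]

theorem quadratisation_law {Ω : Type*} [MeasurableSpace Ω] {P : Measure Ω}
    [IsProbabilityMeasure P] {b : ℕ} (hb : ∀ x : 𝕜, |Algebra.norm ℝ x| = ‖x‖ ^ b) (h : N < M)
    {X : Ω → Matrix (Fin M) (Fin N) 𝕜} (hX : HasLaw X (gaussianMatrix M N 𝕜 b) P) :
    (∀ᵐ ω ∂P, ∀ G : Matrix (Fin N) (Fin N) 𝕜,
      (∃ W ∈ Matrix.unitaryGroup (Fin M) 𝕜,
        HasCanonicalForm h W ∧ X ω = W * padZero h G) ↔ G = quadratisation h (X ω)) ∧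
    HasLaw (fun ω => quadratisation h (X ω)) (inducedGinibre N ((M : ℝ) - N) 𝕜 b) P := by
  -- No Gaussian integral is computed: the measure is the law of `X`, hence has mass one.
  have hprob : IsProbabilityMeasure (gaussianMatrix M N 𝕜 b) := by
    rw [← hX.map_eq]
    exact Measure.isProbabilityMeasure_map hX.aemeasurable
  constructor
  · have hae : ∀ᵐ A ∂P.map X, (upperBlock h A).det ≠ 0 := by
      rw [hX.map_eq]
      exact Measure.ae_smul_measure
        ((withDensity_absolutelyContinuous _ _).ae_le (ae_det_upperBlock_ne_zero h)) _
    exact (ae_of_ae_map hX.aemeasurable hae).mono fun ω hω G => exists_eq_mul_padZero_iff h hω G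
  · refine ⟨(measurable_quadratisation h).comp_aemeasurable hX.aemeasurable, ?_⟩
    rw [← map_quadratisation_gaussianMatrix hb h hprob, ← hX.map_eq,
      AEMeasurable.map_map_of_aemeasurable (measurable_quadratisation h).aemeasurable
        hX.aemeasurable]
    rfl

end Law

end InducedGinibre

open InducedGinibre in
theorem lemma2 {Ω : Type*} [MeasurableSpace Ω] (P : Measure Ω) [IsProbabilityMeasure P]
    (M N : ℕ) (h : N < M) :
    -- real matrices, `β = 1`
    (∀ X : Ω → Matrix (Fin M) (Fin N) ℝ,
      HasLaw X (gaussianMatrix M N ℝ 1) P →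
        (∀ᵐ ω ∂P, ∀ G : Matrix (Fin N) (Fin N) ℝ,
          (∃ W ∈ Matrix.orthogonalGroup (Fin M) ℝ,
            HasCanonicalForm h W ∧ X ω = W * padZero h G) ↔ G = quadratisation h (X ω)) ∧
        HasLaw (fun ω => quadratisation h (X ω)) (inducedGinibre N ((M : ℝ) - N) ℝ 1) P) ∧
    -- complex matrices, `β = 2`
    (∀ X : Ω → Matrix (Fin M) (Fin N) ℂ,
      HasLaw X (gaussianMatrix M N ℂ 2) P →
        (∀ᵐ ω ∂P, ∀ G : Matrix (Fin N) (Fin N) ℂ,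
          (∃ W ∈ Matrix.unitaryGroup (Fin M) ℂ,
            HasCanonicalForm h W ∧ X ω = W * padZero h G) ↔ G = quadratisation h (X ω)) ∧
        HasLaw (fun ω => quadratisation h (X ω)) (inducedGinibre N ((M : ℝ) - N) ℂ 2) P) := by
  constructor
  · intro X hX
    have hb : ∀ x : ℝ, |Algebra.norm ℝ x| = ‖x‖ ^ 1 := by
      intro x
      rw [Algebra.norm_self, MonoidHom.id_apply, pow_one, Real.norm_eq_abs]
    have := quadratisation_law (b := 1) hb h (by rw [Nat.cast_one]; exact hX)
    rw [Nat.cast_one] at this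
    exact this
  · intro X hX
    have hb : ∀ x : ℂ, |Algebra.norm ℝ x| = ‖x‖ ^ 2 := by
      intro x
      rw [Algebra.norm_complex_apply, Complex.normSq_eq_norm_sq, abs_of_nonneg (sq_nonneg _)]
    have := quadratisation_law (b := 2) hb h (by rw [Nat.cast_ofNat]; exact hX)
    rw [Nat.cast_ofNat] at this
    exact this
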